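/- Let $G$ be a finite group. For $a=\sum_g a_g g$ and $b=\sum_g b_g g$ in $\mathbb{C}G$ the Hadamard product is $a\circ b=\sum_g a_gb_g g$, with unit $\sum_g g$. A supercharacter theory of $G$ is a subspace $\mathsf{S}\subseteq Z(\mathbb{C}G)$ that is a unital subalgebra both for the ordinary product (so $1\in\mathsf S$) and for the Hadamard product (so $\sum_g g\in\mathsf S$). With respect to each of the two products $\mathsf{S}$ has a unique basis of orthogonal (equivalently, primitive) idempotents. For the Hadamard product these are the elements $\widehat K=\sum_{g\in K}g$ for $K$ in a partition $\mathrm{Cl}(\mathsf S)$ of $G$, whose parts are called the $\mathsf{S}$-classes; $\mathrm{cl}_{\mathsf S}(g)$ denotes the $\mathsf{S}$-class containing $g$. For the ordinary product these are the elements $\sum_{\psi\in X}e_\psi$ for $X$ in a partition $\mathrm{Ch}(\mathsf S)$ of the set $\mathrm{Irr}(G)$ of complex irreducible characters, where $e_\psi=\frac{1}{|G|}\sum_{g\in G}\psi(1)\psi(g^{-1})g$. The basic $\mathsf{S}$-characters are the characters $\sigma_X=\sum_{\psi\in X}\psi(1)\psi$ with $X\in\mathrm{Ch}(\mathsf S)$;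 their set is denoted by $\mathrm{BCh}(\mathsf S)$. Theorem. Let $\mathsf{S}$ be a supercharacter theory of the finite group $G$. Let $C\subseteq G$ be a set of representatives of the $\mathsf{S}$-classes, let $x_g$ $(g\in C)$ be independent indeterminates, and let $\kappa:G\to C$ send each element of $G$ to the representative in $C$ of its $\mathsf{S}$-class. Let $\Theta_{\mathsf S}=\det\bigl(x_{\kappa(gh^{-1})}\bigr)_{g,h\in G}$. Then, in the polynomial ring $\mathbb{C}[x_g : g\in C]$, \[\Theta_{\mathsf S}=\prod_{\chi\in\mathrm{BCh}(\mathsf S)}\left(\sum_{g\in C}\frac{\chi(g)\,|\mathrm{cl}_{\mathsf S}(g)|}{\chi(1)}\,x_g\right)^{\chi(1)}.\] -/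

import Mathlib

/-- A supercharacter theory of a finite group `G`: a subspace of the centre of `ℂ[G]` which is a
unital subalgebra both for the ordinary product and for the Hadamard (coefficientwise) product,
whose unit is `∑ g, g`. -/
structure SupercharacterTheory (G : Type*) [Group G] [Fintype G]
    extends Subalgebra ℂ (MonoidAlgebra ℂ G) where
  le_center : toSubalgebra ≤ Subalgebra.center ℂ (MonoidAlgebra ℂ G)
  hadamard_one_mem : (∑ g : G, MonoidAlgebra.single g (1 : ℂ)) ∈ carrier
  hadamard_mul_mem : ∀ {a b : MonoidAlgebra ℂ G}, a ∈ carrier → b ∈ carrier →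
    (∑ g : G, MonoidAlgebra.single g (a.coeff g * b.coeff g)) ∈ carrier

namespace SupercharacterTheory

variable {G : Type*} [Group G] [Fintype G]

/-- The sum `K̂ = ∑_{g ∈ K} g` in `ℂ[G]`. The elements of this form are exactly the idempotents
of `ℂ[G]` for the Hadamard product. -/
noncomputable def setSum (K : Set G) : MonoidAlgebra ℂ G :=
  ∑ g : G, MonoidAlgebra.single g (K.indicator 1 g)

/-- The set `Irr(G)` of complex irreducible characters of `G`. -/
def irr (G : Type*) [Group G] : Set (G → ℂ) :=
  {ψ | ∃ (n : ℕ) (ρ : Representation ℂ G (Fin n → ℂ)), ρ.IsIrreducible ∧ ρ.character = ψ}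

/-- The element `e_ψ = |G|⁻¹ ∑_g ψ(1) ψ(g⁻¹) g` of `ℂ[G]`; for irreducible `ψ` these are the
primitive idempotents of the centre of `ℂ[G]`. -/
noncomputable def charIdempotent (ψ : G → ℂ) : MonoidAlgebra ℂ G :=
  ∑ g : G, MonoidAlgebra.single g (ψ 1 * ψ g⁻¹ / (Fintype.card G : ℂ))

/-- `σ_X = ∑_{ψ ∈ X} ψ(1) ψ`. -/
noncomputable def sigma (X : Finset (G → ℂ)) : G → ℂ :=
  ∑ ψ ∈ X, ψ 1 • ψ

/-- `Cl(S)`: the `S`-classes, that is, the sets `K` for which `K̂` is a primitive idempotent of `S`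
for the Hadamard product (these `K̂` are the basis of orthogonal idempotents of `S` for that
product). -/
def superclasses (S : SupercharacterTheory G) : Set (Set G) :=
  {K | Minimal (fun L : Set G => L.Nonempty ∧ setSum L ∈ S.toSubalgebra) K}

/-- `cl_S(g)`: the `S`-class containing `g`. -/
def cl (S : SupercharacterTheory G) (g : G) : Set G :=
  {h | ∃ K ∈ S.superclasses, g ∈ K ∧ h ∈ K}

/-- `Ch(S)`: the sets `X` of irreducible characters for which `∑_{ψ ∈ X} e_ψ` is a primitive
idempotent of `S` for the ordinary product (these sums are the basis of orthogonal idempotents of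
`S` for that product). -/
def charParts (S : SupercharacterTheory G) : Set (Finset (G → ℂ)) :=
  {X | Minimal (fun Y : Finset (G → ℂ) => (Y : Set (G → ℂ)) ⊆ irr G ∧ Y.Nonempty ∧
    ∑ ψ ∈ Y, charIdempotent ψ ∈ S.toSubalgebra) X}

/-- `BCh(S)`: the basic `S`-characters `σ_X`, for `X ∈ Ch(S)`. -/
def basicChars (S : SupercharacterTheory G) : Set (G → ℂ) :=
  sigma '' S.charParts

/-- `C` contains exactly one element of each `S`-class. -/
def IsClassReps (S : SupercharacterTheory G) (C : Finset G) : Prop :=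
  ∀ K ∈ S.superclasses, ∃! g, g ∈ C ∧ g ∈ K

/-- The degree `χ(1)` as a natural number; see `natCast_degree`. -/
noncomputable def degree (χ : G → ℂ) : ℕ := ⌊(χ 1).re⌋₊

/-- The `S`-classes partition `G`. -/
theorem isPartition_superclasses (S : SupercharacterTheory G) :
    Setoid.IsPartition S.superclasses := by
  classical
  have coeffS : ∀ (L : Set G) (g : G), (setSum L).coeff g = L.indicator 1 g := by
    intro L g
    simp [setSum, MonoidAlgebra.coeff_sum, Finsupp.finsetSum_apply, Finsupp.single_apply]
  have hinter : ∀ K L : Set G, setSum K ∈ S.toSubalgebra → setSum L ∈ S.toSubalgebra →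
      setSum (K ∩ L) ∈ S.toSubalgebra := by
    intro K L hK hL
    have h := S.hadamard_mul_mem hK hL
    have e : (∑ g : G, MonoidAlgebra.single g ((setSum K).coeff g * (setSum L).coeff g))
        = setSum (K ∩ L) := by
      simp only [coeffS]
      refine Finset.sum_congr rfl fun g _ => ?_
      rw [Set.inter_indicator_one]
      rfl
    rw [e] at h
    exact h
  have hdiff : ∀ K L : Set G, L ⊆ K → setSum K ∈ S.toSubalgebra → setSum L ∈ S.toSubalgebra →
      setSum (K \ L) ∈ S.toSubalgebra := by
    intro K L hLK hK hL
    have h := S.toSubalgebra.sub_mem hK hL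
    have e : setSum K - setSum L = setSum (K \ L) := by
      rw [setSum, setSum, setSum, ← Finset.sum_sub_distrib]
      refine Finset.sum_congr rfl fun g _ => ?_
      rw [← MonoidAlgebra.single_sub]
      congr 1
      by_cases h1 : g ∈ L
      · simp [h1, hLK h1]
      · by_cases h2 : g ∈ K <;> simp [h1, h2]
    rwa [e] at h
  refine ⟨fun h => Set.not_nonempty_empty h.1.1, fun g => ?_⟩
  have huniv : setSum (Set.univ : Set G) ∈ S.toSubalgebra := by
    simpa [setSum] using S.hadamard_one_mem
  obtain ⟨K, hK⟩ := (Set.toFinite {L : Set G | g ∈ L ∧ setSum L ∈ S.toSubalgebra}).exists_minimal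
    ⟨Set.univ, Set.mem_univ g, huniv⟩
  have hKc : K ∈ S.superclasses := by
    refine ⟨⟨⟨g, hK.prop.1⟩, hK.prop.2⟩, fun L hL hLK => ?_⟩
    by_cases hg : g ∈ L
    · exact hK.2 ⟨hg, hL.2⟩ hLK
    · have hKL : g ∈ K \ L ∧ setSum (K \ L) ∈ S.toSubalgebra :=
        ⟨⟨hK.prop.1, hg⟩, hdiff K L hLK hK.prop.2 hL.2⟩
      have := hK.2 hKL Set.sdiff_subset
      obtain ⟨y, hy⟩ := hL.1
      exact absurd hy (this (hLK hy)).2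
  refine ⟨K, ⟨hKc, hK.prop.1⟩, ?_⟩
  rintro L ⟨hL, hgL⟩
  have hI : (K ∩ L).Nonempty ∧ setSum (K ∩ L) ∈ S.toSubalgebra :=
    ⟨⟨g, hK.prop.1, hgL⟩, hinter K L hK.prop.2 hL.1.2⟩
  exact Set.Subset.antisymm (fun x hx => (hL.2 hI Set.inter_subset_right hx).1)
    (fun x hx => (hKc.2 hI Set.inter_subset_left hx).2)

/-- `Irr(G)` is finite. -/
theorem finite_irr (G : Type*) [Group G] [Fintype G] : (irr G).Finite := by
  classical
  have : Invertible (Nat.card G : ℂ) := invertibleOfNonzero (by simp)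
  have horth : ∀ ψ ∈ irr G, ∀ φ ∈ irr G,
      (Nat.card G : ℂ)⁻¹ * ∑ g : G, ψ g * φ g⁻¹ = if ψ = φ then 1 else 0 := by
    rintro _ ⟨n, ρ, hρ, rfl⟩ _ ⟨m, τ, hτ, rfl⟩
    have key := Representation.char_orthonormal ρ τ
    have key2 := Representation.char_orthonormal τ τ
    rw [if_pos ⟨Representation.Equiv.refl τ⟩] at key2
    by_cases h : ρ.character = τ.character
    · rw [if_pos h, h, key2]
    · rw [if_neg h, key, if_neg]
      rintro ⟨e⟩
      exact h (Representation.char_iso e).symm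
  have hli : LinearIndependent ℂ (fun ψ : irr G => (ψ : G → ℂ)) := by
    rw [linearIndependent_iff']
    intro s c hc i hi
    have h0 : ∑ j ∈ s, c j * ((Nat.card G : ℂ)⁻¹ * ∑ g : G, j.1 g * i.1 g⁻¹) = 0 := by
      have : ∀ g : G, ∑ j ∈ s, c j * j.1 g = 0 := fun g => by
        simpa using congrFun hc g
      calc _ = (Nat.card G : ℂ)⁻¹ * ∑ g : G, (∑ j ∈ s, c j * j.1 g) * i.1 g⁻¹ := by
            simp only [Finset.mul_sum, Finset.sum_mul]
            rw [Finset.sum_comm]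
            refine Finset.sum_congr rfl fun _ _ => Finset.sum_congr rfl fun _ _ => by ring
        _ = 0 := by simp [this]
    rw [Finset.sum_congr rfl fun j _ => by rw [horth _ j.2 _ i.2]] at h0
    simpa [Subtype.coe_inj, hi] using h0
  exact hli.setFinite

/-- `BCh(S)` is finite. -/
theorem finite_basicChars (S : SupercharacterTheory G) : S.basicChars.Finite := by
  classical
  refine Set.Finite.image _ (((finite_irr G).toFinset.powerset.finite_toSet).subset fun X hX => ?_)
  simpa [Finset.subset_iff, Set.subset_def] using hX.1.1

/-- For a basic `S`-character `χ`, the number `χ(1)` is a positive integer. -/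
theorem natCast_degree (S : SupercharacterTheory G) {χ : G → ℂ} (hχ : χ ∈ S.basicChars) :
    (degree χ : ℂ) = χ 1 ∧ 0 < degree χ := by
  obtain ⟨X, hX, rfl⟩ := hχ
  have hn : ∀ ψ ∈ X, ∃ n : ℕ, 0 < n ∧ ψ 1 = n := by
    intro ψ hψ
    obtain ⟨n, ρ, hρ, rfl⟩ := hX.1.1 hψ
    refine ⟨n, Nat.pos_of_ne_zero ?_, by simp⟩
    rintro rfl
    obtain ⟨a, b, hab⟩ := hρ.toNontrivial
    exact hab (SetLike.ext fun x => by
      rw [Subsingleton.elim x 0]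
      exact iff_of_true a.toSubmodule.zero_mem b.toSubmodule.zero_mem)
  choose! n hpos hn using hn
  have h : sigma X 1 = ((∑ ψ ∈ X, n ψ * n ψ : ℕ) : ℂ) := by
    rw [sigma, Finset.sum_apply]
    push_cast
    exact Finset.sum_congr rfl fun ψ hψ => by simp [hn ψ hψ]
  have hd : degree (sigma X) = ∑ ψ ∈ X, n ψ * n ψ := by
    rw [degree, h, Complex.natCast_re, Nat.floor_natCast]
  rw [hd]
  exact ⟨h.symm, Finset.sum_pos (fun ψ hψ => Nat.mul_pos (hpos ψ hψ) (hpos ψ hψ)) hX.1.2.1⟩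

end SupercharacterTheory

namespace SupercharacterTheory

variable {G : Type*} [Group G] [Fintype G]

/-! Specialise the indeterminates to numbers `v`. The matrix becomes that of left multiplication on
`ℂ[G]` by `a = ∑ v (κ g) g`, a combination of class sums and hence an element of `S`. Write `e_X`
for `∑ ψ ∈ X, charIdempotent ψ`. The `e_X`, for `X` in `Ch(S)`, are orthogonal idempotents with sum
1, and `a = ∑ λ_X e_X` (`eq_sum_charParts`). The determinant is therefore the product of the `λ_X`,
each raised to the rank of left multiplication by `e_X`; this rank is a trace, `|G|` times the
coefficient of `e_X` at 1, that is `σ_X(1)` (`det_groupMatrix`).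

The eigenvalue `λ_X` is the common value at `a` of the central characters of all `ψ ∈ X`, and a
weighted average expresses it through `σ_X` (`centralChar_eq_centralChar_sigma`). Since `σ_X` is
constant on classes (`sigma_eq_of_mem_superclass`), the sum over `G` collapses to one over `C`. -/

theorem coeff_sum_single {G : Type*} [Fintype G] (f : G → ℂ) (g : G) :
    (∑ h : G, MonoidAlgebra.single h (f h)).coeff g = f g := by
  classical
  simp [MonoidAlgebra.coeff_sum, Finsupp.finsetSum_apply, Finsupp.single_apply]

theorem sum_single_coeff {G : Type*} [Fintype G] (a : MonoidAlgebra ℂ G) :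
    ∑ h : G, MonoidAlgebra.single h (a.coeff h) = a := by
  ext g
  exact coeff_sum_single _ g

theorem coeff_setSum {G : Type*} [Fintype G] (L : Set G) (g : G) : (setSum L).coeff g = L.indicator 1 g :=
  coeff_sum_single _ g

theorem coeff_charIdempotent (ψ : G → ℂ) (g : G) :
    (charIdempotent ψ).coeff g = ψ 1 * ψ g⁻¹ / (Fintype.card G : ℂ) :=
  coeff_sum_single _ g

theorem coeff_mul_eq_sum (a b : MonoidAlgebra ℂ G) (g : G) :
    (a * b).coeff g = ∑ h : G, a.coeff h * b.coeff (h⁻¹ * g) := by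
  conv_lhs => rw [← sum_single_coeff a]
  rw [Finset.sum_mul, MonoidAlgebra.coeff_sum, Finsupp.finsetSum_apply]
  refine Finset.sum_congr rfl fun h _ => ?_
  rw [MonoidAlgebra.coeff_single_mul_apply]

theorem asAlgebraHom_eq_sum {V : Type*} [AddCommGroup V] [Module ℂ V]
    (ρ : Representation ℂ G V) (a : MonoidAlgebra ℂ G) :
    ρ.asAlgebraHom a = ∑ g : G, a.coeff g • ρ g := by
  conv_lhs => rw [← sum_single_coeff a]
  simp

/-! ### Central characters and the idempotents of the centre. -/

theorem mem_center_of_coeff_conj {a : MonoidAlgebra ℂ G}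
    (h : ∀ g x : G, a.coeff (x * g * x⁻¹) = a.coeff g) :
    a ∈ Subalgebra.center ℂ (MonoidAlgebra ℂ G) := by
  rw [Subalgebra.mem_center_iff]
  intro b
  ext g
  rw [coeff_mul_eq_sum, coeff_mul_eq_sum]
  refine Fintype.sum_equiv (Equiv.divLeft g) _ _ fun x => ?_
  have := h (x⁻¹ * g) x
  simp only [Equiv.divLeft_apply, div_eq_mul_inv, mul_inv_rev, inv_inv, mul_assoc,
    mul_inv_cancel_left, inv_mul_cancel, mul_one] at this ⊢
  rw [this, mul_comm]

/-- The central character of `ψ`, extended linearly to all of `ℂ[G]`. -/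
noncomputable def centralChar (ψ : G → ℂ) (a : MonoidAlgebra ℂ G) : ℂ :=
  (∑ g : G, a.coeff g * ψ g) / ψ 1

theorem irr_one_eq_natCast {G : Type*} [Group G] {ψ : G → ℂ} (hψ : ψ ∈ irr G) : ∃ n : ℕ, 0 < n ∧ ψ 1 = n := by
  obtain ⟨n, ρ, hρ, rfl⟩ := hψ
  refine ⟨n, Nat.pos_of_ne_zero ?_, by simp⟩
  rintro rfl
  obtain ⟨a, b, hab⟩ := hρ.toNontrivial
  exact hab (SetLike.ext fun x => by
    rw [Subsingleton.elim x 0]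
    exact iff_of_true a.toSubmodule.zero_mem b.toSubmodule.zero_mem)

/-- Schur's lemma: a central element acts by an intertwining map, hence by a scalar, which the trace
identifies. -/
theorem asAlgebraHom_of_mem_center {n : ℕ} (ρ : Representation ℂ G (Fin n → ℂ))
    [hρ : ρ.IsIrreducible] {a : MonoidAlgebra ℂ G}
    (ha : a ∈ Subalgebra.center ℂ (MonoidAlgebra ℂ G)) :
    ρ.asAlgebraHom a = centralChar ρ.character a • 1 := by
  let f : Representation.IntertwiningMap ρ ρ := ⟨ρ.asAlgebraHom a, fun g => by
    rw [← Representation.asAlgebraHom_single_one ρ g]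
    rw [← Module.End.mul_eq_comp, ← Module.End.mul_eq_comp, ← map_mul, ← map_mul, Subalgebra.mem_center_iff.1 ha]⟩
  obtain ⟨c, hc⟩ :=
    (Representation.IsIrreducible.algebraMap_intertwiningMap_bijective_of_isAlgClosed
      (ρ := ρ)).2 f
  have h : ρ.asAlgebraHom a = c • 1 := by
    have := congrArg (fun F : Representation.IntertwiningMap ρ ρ => F.toLinearMap) hc
    rw [← show f.toLinearMap = ρ.asAlgebraHom a from rfl, ← this]
    rfl
  obtain ⟨m, hm, hm'⟩ := irr_one_eq_natCast (G := G) ⟨n, ρ, hρ, rfl⟩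
  have ht := congrArg (LinearMap.trace ℂ (Fin n → ℂ)) h
  rw [asAlgebraHom_eq_sum, map_sum, map_smul] at ht
  rw [h, centralChar]
  congr 1
  rw [eq_div_iff (by rw [hm']; exact_mod_cast hm.ne'), Representation.character, map_one]
  simpa [Representation.character] using ht.symm

/-- The irreducible representations of `G` separate the elements of `ℂ[G]`. -/
theorem eq_zero_of_asAlgebraHom_eq_zero {a : MonoidAlgebra ℂ G}
    (h : ∀ (n : ℕ) (ρ : Representation ℂ G (Fin n → ℂ)), ρ.IsIrreducible →
      ρ.asAlgebraHom a = 0) : a = 0 := by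
  -- A simple left ideal, written in a `ℂ`-basis, is an irreducible representation on some `Fin n →
  -- ℂ`, so `a` annihilates it.
  have hN : ∀ N : Submodule (MonoidAlgebra ℂ G) (MonoidAlgebra ℂ G),
      IsSimpleModule (MonoidAlgebra ℂ G) N → a ∈ N.annihilator := by
    intro N hN
    have : FiniteDimensional ℂ N :=
      inferInstanceAs (FiniteDimensional ℂ (N.restrictScalars ℂ))
    let e : N ≃ₗ[ℂ] (Fin (Module.finrank ℂ N) → ℂ) := (Module.finBasis ℂ N).equivFun
    let F : MonoidAlgebra ℂ G →ₐ[ℂ] Module.End ℂ (Fin (Module.finrank ℂ N) → ℂ) :=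
      (e.conjAlgEquiv ℂ).toAlgHom.comp (Algebra.lsmul ℂ ℂ N)
    let ρ : Representation ℂ G (Fin (Module.finrank ℂ N) → ℂ) :=
      (MonoidAlgebra.lift ℂ _ G).symm F
    have hρ : ρ.asAlgebraHom = F := (MonoidAlgebra.lift ℂ _ G).apply_symm_apply F
    have hF : ∀ b x, F b (e x) = e (b • x) := fun b x => by
      change e (b • e.symm (e x)) = _
      rw [e.symm_apply_apply]
    let E : N ≃ₗ[MonoidAlgebra ℂ G] ρ.asModule :=
      { (e.trans ρ.asModuleEquiv.symm) with
        map_smul' := fun b x => by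
          apply ρ.asModuleEquiv.injective
          rw [Representation.asModuleEquiv_map_smul, hρ]
          exact (hF b x).symm }
    have hirr : ρ.IsIrreducible := by
      rw [Representation.irreducible_iff_isSimpleModule_asModule]
      exact IsSimpleModule.congr E.symm
    rw [Submodule.mem_annihilator]
    intro x hx
    have h0 := hF a ⟨x, hx⟩
    rw [← hρ, h _ ρ hirr, LinearMap.zero_apply, eq_comm, e.map_eq_zero_iff] at h0
    exact congrArg Subtype.val h0
  -- By semisimplicity the simple left ideals span `ℂ[G]`, so `a` annihilates 1.
  have htop : a ∈ (⊤ : Submodule (MonoidAlgebra ℂ G) (MonoidAlgebra ℂ G)).annihilator := by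
    rw [← IsSemisimpleModule.sSup_simples_eq_top, sSup_eq_iSup', Submodule.annihilator_iSup,
      Submodule.mem_iInf]
    exact fun N => hN N N.2
  simpa using Submodule.mem_annihilator.1 htop 1 trivial

theorem coeff_charIdempotent_conj {ψ : G → ℂ} (hψ : ψ ∈ irr G) (g x : G) :
    (charIdempotent ψ).coeff (x * g * x⁻¹) = (charIdempotent ψ).coeff g := by
  obtain ⟨n, ρ, hρ, rfl⟩ := hψ
  simp only [coeff_charIdempotent]
  rw [show (x * g * x⁻¹)⁻¹ = x * g⁻¹ * x⁻¹ by group, Representation.char_conj]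

theorem charIdempotent_mem_center {ψ : G → ℂ} (hψ : ψ ∈ irr G) :
    charIdempotent ψ ∈ Subalgebra.center ℂ (MonoidAlgebra ℂ G) :=
  mem_center_of_coeff_conj (coeff_charIdempotent_conj hψ)

/-- Up to a constant, the coefficient of `e_ψ` at `g` is the trace of `ρ g⁻¹`; multiplying Schur's
scalar identity by `ρ g⁻¹` and taking traces compares the coefficients. -/
theorem mul_charIdempotent {ψ : G → ℂ} (hψ : ψ ∈ irr G) {a : MonoidAlgebra ℂ G}
    (ha : a ∈ Subalgebra.center ℂ (MonoidAlgebra ℂ G)) :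
    a * charIdempotent ψ = centralChar ψ a • charIdempotent ψ := by
  obtain ⟨n, ρ, hρ, rfl⟩ := hψ
  ext g
  have h := congrArg (fun T => LinearMap.trace ℂ (Fin n → ℂ) (ρ g⁻¹ * T))
    (asAlgebraHom_of_mem_center ρ ha)
  simp only [asAlgebraHom_eq_sum, Finset.mul_sum, mul_smul_comm, map_sum, map_smul, mul_one,
    ← map_mul, smul_eq_mul] at h
  rw [coeff_mul_eq_sum, MonoidAlgebra.coeff_smul_apply, smul_eq_mul]
  simp only [coeff_charIdempotent, mul_inv_rev, inv_inv]
  change ∑ x, a.coeff x * ρ.character (g⁻¹ * x) = _ * ρ.character g⁻¹ at h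
  rw [mul_div_assoc', mul_left_comm, ← h, Finset.mul_sum, Finset.sum_div]
  exact Finset.sum_congr rfl fun x _ => by ring

open Classical in
theorem sum_mul_inv_of_mem_irr {ψ φ : G → ℂ} (hψ : ψ ∈ irr G) (hφ : φ ∈ irr G) :
    (Fintype.card G : ℂ)⁻¹ * ∑ g : G, ψ g * φ g⁻¹ = if ψ = φ then 1 else 0 := by
  have : Invertible (Nat.card G : ℂ) := invertibleOfNonzero (by simp)
  obtain ⟨n, ρ, hρ, rfl⟩ := hψ
  obtain ⟨m, τ, hτ, rfl⟩ := hφ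
  rw [Fintype.card_eq_nat_card]
  have key := Representation.char_orthonormal ρ τ
  have key2 := Representation.char_orthonormal τ τ
  rw [if_pos ⟨Representation.Equiv.refl τ⟩] at key2
  by_cases h : ρ.character = τ.character
  · rw [if_pos h, h, key2]
  · rw [if_neg h, key, if_neg]
    rintro ⟨e⟩
    exact h (Representation.char_iso e).symm

theorem irr_one_ne_zero {G : Type*} [Group G] {ψ : G → ℂ} (hψ : ψ ∈ irr G) : ψ 1 ≠ 0 := by
  obtain ⟨n, hn, h⟩ := irr_one_eq_natCast hψ
  rw [h]
  exact_mod_cast hn.ne'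

open Classical in
theorem centralChar_charIdempotent {ψ φ : G → ℂ} (hψ : ψ ∈ irr G) (hφ : φ ∈ irr G) :
    centralChar ψ (charIdempotent φ) = if ψ = φ then 1 else 0 := by
  have h : centralChar ψ (charIdempotent φ) =
      φ 1 / ψ 1 * ((Fintype.card G : ℂ)⁻¹ * ∑ g : G, ψ g * φ g⁻¹) := by
    simp only [centralChar, coeff_charIdempotent, Finset.mul_sum, Finset.sum_div]
    exact Finset.sum_congr rfl fun g _ => by ring
  rw [h, sum_mul_inv_of_mem_irr hψ hφ]
  split_ifs with hh
  · rw [hh, div_self (irr_one_ne_zero hφ), one_mul]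
  · rw [mul_zero]

theorem centralChar_one {ψ : G → ℂ} (hψ : ψ ∈ irr G) : centralChar ψ 1 = 1 := by
  classical
  rw [centralChar, div_eq_one_iff_eq (irr_one_ne_zero hψ),
    Finset.sum_eq_single 1 _ (by simp)]
  · simp [MonoidAlgebra.one_def]
  · intro g _ hg
    simp [MonoidAlgebra.one_def, hg.symm]

theorem centralChar_sub (ψ : G → ℂ) (a b : MonoidAlgebra ℂ G) :
    centralChar ψ (a - b) = centralChar ψ a - centralChar ψ b := by
  simp [centralChar, sub_mul, Finset.sum_sub_distrib, sub_div]

theorem centralChar_smul (ψ : G → ℂ) (c : ℂ) (a : MonoidAlgebra ℂ G) :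
    centralChar ψ (c • a) = c * centralChar ψ a := by
  simp [centralChar, mul_assoc, ← Finset.mul_sum, mul_div_assoc]

theorem centralChar_sum (ψ : G → ℂ) {ι : Type*} (s : Finset ι) (a : ι → MonoidAlgebra ℂ G) :
    centralChar ψ (∑ i ∈ s, a i) = ∑ i ∈ s, centralChar ψ (a i) := by
  simp only [centralChar, MonoidAlgebra.coeff_sum, Finsupp.finsetSum_apply, Finset.sum_mul]
  rw [Finset.sum_comm, Finset.sum_div]

/-- A central element of `ℂ[G]` is determined by its central characters. -/
theorem eq_zero_of_centralChar_eq_zero {a : MonoidAlgebra ℂ G}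
    (ha : a ∈ Subalgebra.center ℂ (MonoidAlgebra ℂ G))
    (h : ∀ ψ ∈ irr G, centralChar ψ a = 0) : a = 0 := by
  refine eq_zero_of_asAlgebraHom_eq_zero fun n ρ hρ => ?_
  rw [asAlgebraHom_of_mem_center ρ ha, h _ ⟨n, ρ, hρ, rfl⟩, zero_smul]

theorem eq_sum_centralChar_smul {a : MonoidAlgebra ℂ G}
    (ha : a ∈ Subalgebra.center ℂ (MonoidAlgebra ℂ G)) :
    a = ∑ ψ ∈ (finite_irr G).toFinset, centralChar ψ a • charIdempotent ψ := by
  classical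
  rw [← sub_eq_zero]
  refine eq_zero_of_centralChar_eq_zero (Subalgebra.sub_mem _ ha (Subalgebra.sum_mem _
    fun ψ hψ => Subalgebra.smul_mem _ (charIdempotent_mem_center (by simpa using hψ)) _))
    fun φ hφ => ?_
  rw [centralChar_sub, centralChar_sum, sub_eq_zero,
    Finset.sum_congr rfl fun ψ hψ => by
      rw [centralChar_smul, centralChar_charIdempotent hφ (by simpa using hψ)]]
  simp [hφ]

theorem sum_charIdempotent : ∑ ψ ∈ (finite_irr G).toFinset, charIdempotent ψ = 1 := by
  refine Eq.trans (Finset.sum_congr rfl fun ψ hψ => ?_)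
    (eq_sum_centralChar_smul (G := G) (Subalgebra.one_mem _)).symm
  rw [centralChar_one (by simpa using hψ), one_smul]

open Classical in
theorem charIdempotent_mul_charIdempotent {ψ φ : G → ℂ} (hψ : ψ ∈ irr G) (hφ : φ ∈ irr G) :
    charIdempotent ψ * charIdempotent φ = if ψ = φ then charIdempotent ψ else 0 := by
  rw [mul_charIdempotent hφ (charIdempotent_mem_center hψ), centralChar_charIdempotent hφ hψ]
  by_cases h : ψ = φ
  · rw [if_pos h.symm, if_pos h, one_smul, h]
  · rw [if_neg (Ne.symm h), if_neg h, zero_smul]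

/-- Let `f` be the adjoint of `e = e_ψ`, with coefficients `conj (e g⁻¹)`. It is central, so `f * e
= r • e`, where `r` is the mean of `|ψ|²`, real and nonzero. As `f * e` is self-adjoint, so is `e`.
No unitary structure on the representation is needed. -/
theorem charIdempotent_inv {ψ : G → ℂ} (hψ : ψ ∈ irr G) (g : G) :
    (charIdempotent ψ).coeff g⁻¹ = (starRingEnd ℂ) ((charIdempotent ψ).coeff g) := by
  set e := charIdempotent ψ with he
  let f : MonoidAlgebra ℂ G := ∑ g : G, MonoidAlgebra.single g ((starRingEnd ℂ) (e.coeff g⁻¹))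
  have hf : ∀ g, f.coeff g = (starRingEnd ℂ) (e.coeff g⁻¹) := coeff_sum_single _
  have hfc : f ∈ Subalgebra.center ℂ (MonoidAlgebra ℂ G) :=
    mem_center_of_coeff_conj fun g x => by
      rw [hf, hf, show (x * g * x⁻¹)⁻¹ = x * g⁻¹ * x⁻¹ by group, coeff_charIdempotent_conj hψ]
  have hmul := mul_charIdempotent hψ hfc
  obtain ⟨n, hn, hn1⟩ := irr_one_eq_natCast hψ
  obtain ⟨r, hr, hr0⟩ : ∃ r : ℝ, centralChar ψ f = r ∧ r ≠ 0 := by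
    refine ⟨(∑ g : G, Complex.normSq (ψ g)) / Fintype.card G, ?_, ?_⟩
    · rw [centralChar]
      push_cast
      rw [Finset.sum_div, Finset.sum_div]
      refine Finset.sum_congr rfl fun x _ => ?_
      rw [hf, he, coeff_charIdempotent, inv_inv, Complex.normSq_eq_conj_mul_self, hn1]
      have : (n : ℂ) ≠ 0 := by exact_mod_cast hn.ne'
      simp only [map_div₀, map_mul, Complex.conj_natCast]
      field_simp
    · refine (div_pos (Finset.sum_pos' (fun x _ => Complex.normSq_nonneg _)
        ⟨1, Finset.mem_univ _, ?_⟩) (by exact_mod_cast Fintype.card_pos)).ne'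
      exact Complex.normSq_pos.2 (irr_one_ne_zero hψ)
  rw [hr] at hmul
  have hcoeff : ∀ g, ∑ h : G, f.coeff h * e.coeff (h⁻¹ * g) = r * e.coeff g := fun g => by
    rw [← coeff_mul_eq_sum, hmul]
    rfl
  have hsymm : (starRingEnd ℂ) (r * e.coeff g) = r * e.coeff g⁻¹ := by
    rw [← hcoeff, ← hcoeff, map_sum]
    refine Fintype.sum_equiv (Equiv.mulLeft g⁻¹) _ _ fun x => ?_
    simp only [hf, map_mul, Complex.conj_conj, Equiv.coe_mulLeft, mul_inv_rev, inv_inv]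
    rw [mul_comm]
    congr 2
    group
  rw [map_mul, Complex.conj_ofReal] at hsymm
  exact (mul_left_cancel₀ (by exact_mod_cast hr0) hsymm).symm

/-! ### Primitive idempotents of `S` for the two products. -/

theorem exists_eval_eq_one_of_notMem {c : ℂ} {T : Finset ℂ} (hc : c ∉ T) :
    ∃ p : Polynomial ℂ, p.eval c = 1 ∧ ∀ d ∈ T, p.eval d = 0 := by
  have h0 : ∏ d ∈ T, (c - d) ≠ 0 :=
    Finset.prod_ne_zero_iff.2 fun d hd => sub_ne_zero.2 fun h => hc (h ▸ hd)
  refine ⟨.C (∏ d ∈ T, (c - d))⁻¹ * ∏ d ∈ T, (.X - .C d), ?_, fun d hd => ?_⟩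
  · simp [Polynomial.eval_prod, h0]
  · simp only [Polynomial.eval_mul, Polynomial.eval_prod, Polynomial.eval_sub, Polynomial.eval_X,
      Polynomial.eval_C]
    rw [Finset.prod_eq_zero hd (sub_self d), mul_zero]

/-- A supercharacter theory is closed under applying a polynomial to all coefficients. -/
theorem sum_single_eval_mem (S : SupercharacterTheory G) {a : MonoidAlgebra ℂ G}
    (ha : a ∈ S.toSubalgebra) (p : Polynomial ℂ) :
    ∑ g : G, MonoidAlgebra.single g (p.eval (a.coeff g)) ∈ S.toSubalgebra := by
  induction p using Polynomial.induction_on with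
  | C c =>
    convert S.toSubalgebra.smul_mem S.hadamard_one_mem c using 1
    simp [Finset.smul_sum]
  | add p q hp hq =>
    convert S.toSubalgebra.add_mem hp hq using 1
    simp [MonoidAlgebra.single_add, Finset.sum_add_distrib]
  | monomial n c h =>
    convert S.hadamard_mul_mem h ha using 1
    simp_rw [coeff_sum_single]
    simp [pow_succ, mul_assoc]

/-- An interpolating polynomial, applied to coefficients, cuts out of `K` the level set of `a`
through `g`. The sum of that set lies in `S`, so minimality of `K` makes it all of `K`. -/
theorem coeff_eq_of_mem_superclass (S : SupercharacterTheory G) {a : MonoidAlgebra ℂ G}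
    (ha : a ∈ S.toSubalgebra) {K : Set G} (hK : K ∈ S.superclasses) {g h : G} (hg : g ∈ K)
    (hh : h ∈ K) : a.coeff h = a.coeff g := by
  classical
  obtain ⟨p, hp1, hp0⟩ := exists_eval_eq_one_of_notMem
    (Finset.notMem_erase (a.coeff g) (Finset.univ.image a.coeff))
  have hb := S.hadamard_mul_mem hK.1.2 (S.sum_single_eval_mem ha p)
  have heq : ∑ x : G, MonoidAlgebra.single x ((setSum K).coeff x *
      (∑ y : G, MonoidAlgebra.single y (p.eval (a.coeff y))).coeff x) =
      setSum (K ∩ {x | a.coeff x = a.coeff g}) := by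
    refine Finset.sum_congr rfl fun x _ => ?_
    rw [coeff_sum_single, coeff_setSum]
    congr 1
    by_cases hx : x ∈ K <;> by_cases hxg : a.coeff x = a.coeff g
    · simp [hx, hxg, hp1]
    · simp [hx, hxg, hp0]
    · simp [hx]
    · simp [hx]
  have hb' : setSum (K ∩ {x | a.coeff x = a.coeff g}) ∈ S.toSubalgebra := heq ▸ hb
  have hle := hK.2 (y := K ∩ {x | a.coeff x = a.coeff g}) ⟨⟨g, hg, rfl⟩, hb'⟩
    Set.inter_subset_left
  exact (hle hh).2

theorem coeff_sum_charIdempotent (X : Finset (G → ℂ)) (g : G) :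
    (∑ ψ ∈ X, charIdempotent ψ).coeff g = sigma X g⁻¹ / (Fintype.card G : ℂ) := by
  simp [MonoidAlgebra.coeff_sum, Finsupp.finsetSum_apply, coeff_charIdempotent, sigma,
    Finset.sum_div]

open Classical in
theorem sum_charIdempotent_mul {X Y : Finset (G → ℂ)} (hX : (X : Set (G → ℂ)) ⊆ irr G)
    (hY : (Y : Set (G → ℂ)) ⊆ irr G) :
    (∑ ψ ∈ X, charIdempotent ψ) * ∑ ψ ∈ Y, charIdempotent ψ =
      ∑ ψ ∈ X ∩ Y, charIdempotent ψ := by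
  rw [Finset.sum_mul_sum, ← Finset.filter_mem_eq_inter, Finset.sum_filter]
  refine Finset.sum_congr rfl fun ψ hψ => ?_
  rw [Finset.sum_congr rfl fun φ hφ => charIdempotent_mul_charIdempotent (hX hψ) (hY hφ)]
  simp

theorem aeval_mul_charIdempotent {ψ : G → ℂ} (hψ : ψ ∈ irr G) {a : MonoidAlgebra ℂ G}
    (ha : a ∈ Subalgebra.center ℂ (MonoidAlgebra ℂ G)) (p : Polynomial ℂ) :
    Polynomial.aeval a p * charIdempotent ψ =
      p.eval (centralChar ψ a) • charIdempotent ψ := by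
  induction p using Polynomial.induction_on with
  | C c => simp [Algebra.smul_def]
  | add p q hp hq => simp [add_mul, add_smul, hp, hq]
  | monomial n c h =>
    rw [pow_succ, ← mul_assoc, map_mul, Polynomial.aeval_X, mul_assoc, mul_charIdempotent hψ ha,
      mul_smul_comm, h, smul_smul, Polynomial.eval_mul_X, mul_comm]

/-- The dual of `coeff_eq_of_mem_superclass`: a polynomial in `a` for the ordinary product cuts out
of `X` a level set of the central characters, and `X` is minimal. -/
theorem centralChar_eq_of_mem_charParts (S : SupercharacterTheory G) {a : MonoidAlgebra ℂ G}
    (ha : a ∈ S.toSubalgebra) {X : Finset (G → ℂ)} (hX : X ∈ S.charParts) {ψ φ : G → ℂ}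
    (hψ : ψ ∈ X) (hφ : φ ∈ X) : centralChar φ a = centralChar ψ a := by
  classical
  obtain ⟨p, hp1, hp0⟩ := exists_eval_eq_one_of_notMem
    (Finset.notMem_erase (centralChar ψ a) (X.image fun θ => centralChar θ a))
  have hb := S.toSubalgebra.mul_mem (Algebra.adjoin_le (Set.singleton_subset_iff.2 ha)
    (Polynomial.aeval_mem_adjoin_singleton ℂ a (p := p))) hX.1.2.2
  have heq : Polynomial.aeval a p * ∑ θ ∈ X, charIdempotent θ =
      ∑ θ ∈ X with centralChar θ a = centralChar ψ a, charIdempotent θ := by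
    rw [Finset.mul_sum, Finset.sum_filter]
    refine Finset.sum_congr rfl fun θ hθ => ?_
    rw [aeval_mul_charIdempotent (hX.1.1 hθ) (S.le_center ha)]
    split_ifs with h
    · rw [h, hp1, one_smul]
    · rw [hp0 _ (Finset.mem_erase.2 ⟨h, Finset.mem_image_of_mem _ hθ⟩), zero_smul]
  rw [heq] at hb
  have hle := hX.2 (y := X.filter fun θ => centralChar θ a = centralChar ψ a)
    ⟨fun θ hθ => hX.1.1 (Finset.mem_of_mem_filter θ hθ),
      ⟨ψ, Finset.mem_filter.2 ⟨hψ, rfl⟩⟩, hb⟩ (Finset.filter_subset _ _)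
  exact (Finset.mem_filter.1 (hle hφ)).2

/-- Take `X` minimal among the admissible sets containing `ψ`. A smaller admissible `Y` avoiding `ψ`
would leave `X \ Y` admissible and containing `ψ`, against that choice. -/
theorem exists_mem_charParts (S : SupercharacterTheory G) {ψ : G → ℂ} (hψ : ψ ∈ irr G) :
    ∃ X ∈ S.charParts, ψ ∈ X := by
  classical
  have hfin : {Y : Finset (G → ℂ) | (Y : Set (G → ℂ)) ⊆ irr G ∧ ψ ∈ Y ∧
      ∑ φ ∈ Y, charIdempotent φ ∈ S.toSubalgebra}.Finite :=
    ((finite_irr G).toFinset.powerset.finite_toSet).subset fun Y hY => by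
      simpa [Finset.subset_iff, Set.subset_def] using hY.1
  obtain ⟨X, hX⟩ := hfin.exists_minimal ⟨(finite_irr G).toFinset, by simp, by simpa using hψ, by
    rw [sum_charIdempotent]; exact S.toSubalgebra.one_mem⟩
  refine ⟨X, ⟨⟨hX.1.1, ⟨ψ, hX.1.2.1⟩, hX.1.2.2⟩, fun Y hY hYX => ?_⟩, hX.1.2.1⟩
  by_cases h : ψ ∈ Y
  · exact hX.2 ⟨hY.1, h, hY.2.2⟩ hYX
  · have hd : ∑ φ ∈ X \ Y, charIdempotent φ ∈ S.toSubalgebra := by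
      rw [Finset.sum_sdiff_eq_sub hYX]
      exact S.toSubalgebra.sub_mem hX.1.2.2 hY.2.2
    have hle := hX.2 (y := X \ Y) ⟨fun φ hφ => hX.1.1 (Finset.mem_sdiff.1 hφ).1,
      Finset.mem_sdiff.2 ⟨hX.1.2.1, h⟩, hd⟩ Finset.sdiff_subset
    obtain ⟨φ, hφ⟩ := hY.2.1
    exact absurd hφ (Finset.mem_sdiff.1 (hle (hYX hφ))).2

theorem disjoint_of_mem_charParts (S : SupercharacterTheory G) {X Y : Finset (G → ℂ)}
    (hX : X ∈ S.charParts) (hY : Y ∈ S.charParts) (hXY : X ≠ Y) : Disjoint X Y := by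
  classical
  by_contra h
  have hne : (X ∩ Y).Nonempty := Finset.not_disjoint_iff_nonempty_inter.1 h
  have hm : ∑ ψ ∈ X ∩ Y, charIdempotent ψ ∈ S.toSubalgebra := by
    rw [← sum_charIdempotent_mul hX.1.1 hY.1.1]
    exact S.toSubalgebra.mul_mem hX.1.2.2 hY.1.2.2
  have hi : ((X ∩ Y : Finset (G → ℂ)) : Set (G → ℂ)) ⊆ irr G :=
    fun ψ hψ => hX.1.1 (Finset.mem_inter.1 hψ).1
  exact hXY (le_antisymm
    ((hX.2 ⟨hi, hne, hm⟩ Finset.inter_subset_left).trans Finset.inter_subset_right)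
    ((hY.2 ⟨hi, hne, hm⟩ Finset.inter_subset_right).trans Finset.inter_subset_left))

theorem finite_charParts (S : SupercharacterTheory G) : S.charParts.Finite :=
  ((finite_irr G).toFinset.powerset.finite_toSet).subset fun X hX => by
    simpa [Finset.subset_iff, Set.subset_def] using hX.1.1

theorem centralChar_sum_charIdempotent {X : Finset (G → ℂ)} (hX : (X : Set (G → ℂ)) ⊆ irr G)
    {ψ : G → ℂ} (hψ : ψ ∈ irr G) (h : ψ ∈ X) :
    centralChar ψ (∑ φ ∈ X, charIdempotent φ) = 1 := by
  classical
  rw [centralChar_sum, Finset.sum_congr rfl fun φ hφ => centralChar_charIdempotent hψ (hX hφ)]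
  simp [h]

/-- Lets a product over `BCh(S)` be indexed by `Ch(S)`. Since `σ_X` determines `e_X`, two distinct
parts with the same `σ` would give an idempotent orthogonal to itself, hence zero. -/
theorem sigma_injOn_charParts (S : SupercharacterTheory G) :
    Set.InjOn sigma S.charParts := by
  intro X hX Y hY h
  by_contra hne
  have heq : ∑ ψ ∈ X, charIdempotent ψ = ∑ ψ ∈ Y, charIdempotent ψ := by
    ext g
    rw [coeff_sum_charIdempotent, coeff_sum_charIdempotent, h]
  classical
  have h0 : ∑ ψ ∈ X, charIdempotent ψ = 0 := by
    have := sum_charIdempotent_mul hX.1.1 hY.1.1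
    rw [← heq, sum_charIdempotent_mul hX.1.1 hX.1.1, Finset.inter_self,
      Finset.disjoint_iff_inter_eq_empty.1 (S.disjoint_of_mem_charParts hX hY hne)] at this
    simpa using this
  obtain ⟨ψ, hψ⟩ := hX.1.2.1
  have h1 := centralChar_sum_charIdempotent hX.1.1 (hX.1.1 hψ) hψ
  rw [h0] at h1
  simp [centralChar] at h1

/-- The eigenvalue of `a ∈ S` on the part `X` of `Irr(G)`, in terms of `σ_X`. -/
theorem centralChar_eq_centralChar_sigma (S : SupercharacterTheory G) {a : MonoidAlgebra ℂ G}
    (ha : a ∈ S.toSubalgebra) {X : Finset (G → ℂ)} (hX : X ∈ S.charParts) {ψ : G → ℂ}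
    (hψ : ψ ∈ X) : centralChar ψ a = centralChar (sigma X) a := by
  have h1 : sigma X 1 ≠ 0 := by
    have h := S.natCast_degree ⟨X, hX, rfl⟩
    rw [← h.1]
    exact_mod_cast h.2.ne'
  -- Average the common eigenvalue over `X` with weights `φ(1)²`, whose total is `σ_X(1)`.
  have hφ : ∀ φ ∈ X, φ 1 * ∑ g : G, a.coeff g * φ g = φ 1 * φ 1 * centralChar ψ a := by
    intro φ hφ
    rw [← S.centralChar_eq_of_mem_charParts ha hX hψ hφ, centralChar]
    have := irr_one_ne_zero (hX.1.1 hφ)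
    field_simp
  rw [centralChar.eq_def (sigma X), eq_div_iff h1]
  calc centralChar ψ a * sigma X 1 = ∑ φ ∈ X, φ 1 * φ 1 * centralChar ψ a := by
        simp [sigma, Finset.mul_sum, mul_comm]
    _ = ∑ φ ∈ X, φ 1 * ∑ g : G, a.coeff g * φ g :=
        (Finset.sum_congr rfl hφ).symm
    _ = ∑ g : G, a.coeff g * sigma X g := by
        simp only [sigma, Finset.sum_apply, Pi.smul_apply, smul_eq_mul, Finset.mul_sum]
        rw [Finset.sum_comm]
        exact Finset.sum_congr rfl fun _ _ => Finset.sum_congr rfl fun _ _ => by ring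

theorem eq_sum_charParts (S : SupercharacterTheory G) {a : MonoidAlgebra ℂ G}
    (ha : a ∈ S.toSubalgebra) :
    a = ∑ X ∈ S.finite_charParts.toFinset,
      centralChar (sigma X) a • ∑ ψ ∈ X, charIdempotent ψ := by
  classical
  have hU : (finite_irr G).toFinset = S.finite_charParts.toFinset.biUnion id := by
    ext ψ
    simp only [Set.Finite.mem_toFinset, Finset.mem_biUnion, id]
    exact ⟨fun h => S.exists_mem_charParts h, fun ⟨X, hX, h⟩ => hX.1.1 h⟩
  conv_lhs => rw [eq_sum_centralChar_smul (S.le_center ha), hU]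
  rw [Finset.sum_biUnion]
  · refine Finset.sum_congr rfl fun X hX => ?_
    rw [Finset.smul_sum]
    refine Finset.sum_congr rfl fun ψ hψ => ?_
    rw [S.centralChar_eq_centralChar_sigma ha (by simpa using hX) hψ]
  · intro X hX Y hY hne
    exact S.disjoint_of_mem_charParts (by simpa using hX) (by simpa using hY) hne

/-- The coefficients of `e_X` are constant on classes but involve `σ_X(x⁻¹)`; `charIdempotent_inv`
trades the inverse for a complex conjugate. -/
theorem sigma_eq_of_mem_superclass (S : SupercharacterTheory G) {X : Finset (G → ℂ)}
    (hX : X ∈ S.charParts) {K : Set G} (hK : K ∈ S.superclasses) {g h : G} (hg : g ∈ K)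
    (hh : h ∈ K) : sigma X h = sigma X g := by
  have hinv : ∀ x : G, sigma X x = Fintype.card G *
      (starRingEnd ℂ) ((∑ ψ ∈ X, charIdempotent ψ).coeff x) := by
    intro x
    have h1 := coeff_sum_charIdempotent X x⁻¹
    rw [inv_inv, eq_div_iff (by simp), mul_comm] at h1
    rw [← h1, MonoidAlgebra.coeff_sum, Finsupp.finsetSum_apply,
      Finsupp.finsetSum_apply, map_sum]
    congr 1
    exact Finset.sum_congr rfl fun ψ hψ => charIdempotent_inv (hX.1.1 hψ) x
  rw [hinv, hinv, S.coeff_eq_of_mem_superclass hX.1.2.2 hK hg hh]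

end SupercharacterTheory

/-! ### Determinants of combinations of orthogonal idempotents. -/

theorem LinearMap.IsProj.det_one_add_smul {k V : Type*} [Field k] [AddCommGroup V] [Module k V]
    [FiniteDimensional k V] {p : Submodule k V} {f : V →ₗ[k] V} (h : LinearMap.IsProj p f)
    (t : k) : LinearMap.det (1 + t • f) = (1 + t) ^ Module.finrank k p := by
  have hd : 1 + t • f = (p.prodEquivOfIsCompl (LinearMap.ker f) h.isCompl).conj
      (LinearMap.prodMap ((1 + t) • LinearMap.id) LinearMap.id) := by
    conv_lhs => rw [h.eq_conj_prodMap]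
    rw [← map_smul, Module.End.one_eq_id, ← LinearEquiv.conj_id
      (p.prodEquivOfIsCompl (LinearMap.ker f) h.isCompl), ← map_add]
    congr 1
    ext x <;> simp [add_smul]
  rw [hd, LinearEquiv.conj_apply, LinearMap.comp_assoc, LinearMap.det_conj,
    LinearMap.det_prodMap, LinearMap.det_smul, LinearMap.det_id, LinearMap.det_id, mul_one,
    mul_one]

/-- In characteristic zero the trace of an idempotent determines its rank. -/
theorem Matrix.det_one_add_smul_of_isIdempotentElem {k n : Type*} [Field k] [CharZero k]
    [Fintype n] [DecidableEq n] {P : Matrix n n k} (hP : IsIdempotentElem P) {r : ℕ}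
    (hr : P.trace = r) (t : k) : (1 + t • P).det = (1 + t) ^ r := by
  have hf : IsIdempotentElem (Matrix.toLin' P) := by
    rw [IsIdempotentElem, Module.End.mul_eq_comp, ← Matrix.toLin'_mul, hP.eq]
  have hproj := LinearMap.IsIdempotentElem.isProj_range _ hf
  have htr := hproj.trace
  rw [Matrix.trace_toLin'_eq, hr, Nat.cast_inj] at htr
  rw [← LinearMap.det_toLin', map_add, map_smul, Matrix.toLin'_one, htr]
  exact hproj.det_one_add_smul t

/-- Orthogonality kills the cross terms, so the matrix is the product of the factors `1 + t i • P
i`. Perturbing 1 allows induction on `s`, as the `P i` need not sum to 1. -/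
theorem Matrix.det_one_add_sum_smul_of_orthogonal {k n ι : Type*} [Field k] [CharZero k]
    [Fintype n] [DecidableEq n] (s : Finset ι) {P : ι → Matrix n n k} {r : ι → ℕ}
    (hP : ∀ i ∈ s, IsIdempotentElem (P i)) (hr : ∀ i ∈ s, (P i).trace = r i)
    (ho : ∀ i ∈ s, ∀ j ∈ s, i ≠ j → P i * P j = 0) (t : ι → k) :
    (1 + ∑ i ∈ s, t i • P i).det = ∏ i ∈ s, (1 + t i) ^ r i := by
  classical
  induction s using Finset.induction_on with
  | empty => simp
  | insert i s hi ih =>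
    have h0 : P i * ∑ j ∈ s, t j • P j = 0 := by
      rw [Finset.mul_sum]
      refine Finset.sum_eq_zero fun j hj => ?_
      rw [mul_smul_comm, ho i (by simp) j (by simp [hj]) (fun h => hi (h ▸ hj)), smul_zero]
    have hmul : 1 + ∑ j ∈ insert i s, t j • P j =
        (1 + t i • P i) * (1 + ∑ j ∈ s, t j • P j) := by
      rw [Finset.sum_insert hi, add_mul, mul_add, one_mul, one_mul, smul_mul_assoc, mul_add, h0,
        mul_one, add_zero]
      abel
    rw [hmul, Matrix.det_mul, Finset.prod_insert hi,
      Matrix.det_one_add_smul_of_isIdempotentElem (hP i (by simp)) (hr i (by simp)),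
      ih (fun j hj => hP j (by simp [hj])) (fun j hj => hr j (by simp [hj]))
        fun j hj l hl => ho j (by simp [hj]) l (by simp [hl])]

/-! ### The group matrix and its determinant on `S`. -/

namespace SupercharacterTheory

variable {G : Type*} [Group G] [Fintype G]

/-- The matrix of left multiplication by `a` on `ℂ[G]`, in the basis `G`. -/
noncomputable def groupMatrix (G : Type*) [Group G] [Fintype G] [DecidableEq G] :
    MonoidAlgebra ℂ G →ₐ[ℂ] Matrix G G ℂ :=
  AlgHom.ofLinearMap
    { toFun := fun a => Matrix.of fun g h => a.coeff (g * h⁻¹)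
      map_add' := fun a b => by ext; simp
      map_smul' := fun c a => by ext; simp }
    (by
      ext g h
      simp [MonoidAlgebra.one_def, Finsupp.single_apply, Matrix.one_apply, eq_comm,
        mul_inv_eq_one])
    (fun a b => by
      ext g h
      simp only [LinearMap.coe_mk, AddHom.coe_mk, Matrix.of_apply, Matrix.mul_apply]
      rw [coeff_mul_eq_sum]
      refine (Fintype.sum_equiv (Equiv.divLeft g) _ _ fun x => ?_).symm
      simp [div_eq_mul_inv, mul_assoc])

theorem groupMatrix_apply [DecidableEq G] (a : MonoidAlgebra ℂ G) (g h : G) :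
    groupMatrix G a g h = a.coeff (g * h⁻¹) := rfl

theorem trace_groupMatrix [DecidableEq G] (a : MonoidAlgebra ℂ G) :
    (groupMatrix G a).trace = Fintype.card G * a.coeff 1 := by
  simp [Matrix.trace, groupMatrix_apply]

theorem centralChar_sigma_one (S : SupercharacterTheory G) {X : Finset (G → ℂ)}
    (hX : X ∈ S.charParts) : centralChar (sigma X) 1 = 1 := by
  obtain ⟨ψ, hψ⟩ := hX.1.2.1
  rw [← S.centralChar_eq_centralChar_sigma S.toSubalgebra.one_mem hX hψ,
    centralChar_one (hX.1.1 hψ)]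

theorem det_groupMatrix (S : SupercharacterTheory G) [DecidableEq G] {a : MonoidAlgebra ℂ G}
    (ha : a ∈ S.toSubalgebra) :
    (groupMatrix G a).det = ∏ χ ∈ S.finite_basicChars.toFinset, centralChar χ a ^ degree χ := by
  classical
  have hone : (1 : MonoidAlgebra ℂ G) =
      ∑ X ∈ S.finite_charParts.toFinset, ∑ ψ ∈ X, charIdempotent ψ :=
    (S.eq_sum_charParts S.toSubalgebra.one_mem).trans (Finset.sum_congr rfl fun X hX => by
      rw [S.centralChar_sigma_one (by simpa using hX), one_smul])
  -- The shift by 1 puts `a` in the form required by `Matrix.det_one_add_sum_smul_of_orthogonal`.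
  have hexp : a = 1 + ∑ X ∈ S.finite_charParts.toFinset,
      (centralChar (sigma X) a - 1) • ∑ ψ ∈ X, charIdempotent ψ := by
    simp only [sub_smul, one_smul, Finset.sum_sub_distrib]
    rw [← hone, ← S.eq_sum_charParts ha, add_sub_cancel]
  have himage : S.finite_basicChars.toFinset = S.finite_charParts.toFinset.image sigma := by
    ext χ
    simp [basicChars]
  rw [himage, Finset.prod_image (by simpa using S.sigma_injOn_charParts)]
  conv_lhs => rw [hexp, map_add, map_one, map_sum]
  simp only [map_smul]
  rw [Matrix.det_one_add_sum_smul_of_orthogonal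
    (P := fun X => groupMatrix G (∑ ψ ∈ X, charIdempotent ψ))
    (t := fun X => centralChar (sigma X) a - 1) (r := fun X => degree (sigma X))]
  · simp
  · intro X hX
    have hX : X ∈ S.charParts := by simpa using hX
    rw [IsIdempotentElem, ← map_mul, sum_charIdempotent_mul hX.1.1 hX.1.1, Finset.inter_self]
  · intro X hX
    -- The exponent: the trace is `|G| · σ_X(1) / |G|`.
    rw [trace_groupMatrix, coeff_sum_charIdempotent, inv_one,
      (S.natCast_degree ⟨X, by simpa using hX, rfl⟩).1, mul_div_cancel₀]
    simp
  · intro X hX Y hY hne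
    have hX : X ∈ S.charParts := by simpa using hX
    have hY : Y ∈ S.charParts := by simpa using hY
    rw [← map_mul, sum_charIdempotent_mul hX.1.1 hY.1.1,
      Finset.disjoint_iff_inter_eq_empty.1 (S.disjoint_of_mem_charParts hX hY hne),
      Finset.sum_empty, map_zero]

theorem cl_eq_of_mem_superclass (S : SupercharacterTheory G) {K : Set G}
    (hK : K ∈ S.superclasses) {g : G} (hg : g ∈ K) : S.cl g = K := by
  ext h
  refine ⟨?_, fun hh => ⟨K, hK, hg, hh⟩⟩
  rintro ⟨L, hL, hgL, hh⟩
  rwa [(S.isPartition_superclasses.2 g).unique ⟨hK, hg⟩ ⟨hL, hgL⟩]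

theorem cl_mem_superclasses (S : SupercharacterTheory G) (g : G) :
    S.cl g ∈ S.superclasses ∧ g ∈ S.cl g := by
  obtain ⟨K, ⟨hK, hg⟩, -⟩ := S.isPartition_superclasses.2 g
  rw [S.cl_eq_of_mem_superclass hK hg]
  exact ⟨hK, hg⟩

theorem eq_iff_mem_cl_of_isClassReps (S : SupercharacterTheory G) {C : Finset G}
    (hC : S.IsClassReps C) {κ : G → C} (hκ : ∀ g : G, (κ g : G) ∈ S.cl g) (g : G) (k : C) :
    κ g = k ↔ g ∈ S.cl k := by
  constructor
  · rintro rfl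
    rw [S.cl_eq_of_mem_superclass (S.cl_mem_superclasses g).1 (hκ g)]
    exact (S.cl_mem_superclasses g).2
  · intro h
    have hcl := S.cl_eq_of_mem_superclass (S.cl_mem_superclasses k).1 h
    exact Subtype.ext ((hC _ (S.cl_mem_superclasses k).1).unique ⟨(κ g).2, hcl ▸ hκ g⟩
      ⟨k.2, (S.cl_mem_superclasses k).2⟩)

theorem sum_single_comp_mem (S : SupercharacterTheory G) {C : Finset G}
    (hC : S.IsClassReps C) {κ : G → C} (hκ : ∀ g : G, (κ g : G) ∈ S.cl g) (v : C → ℂ) :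
    ∑ g : G, MonoidAlgebra.single g (v (κ g)) ∈ S.toSubalgebra := by
  classical
  have h : ∑ g : G, MonoidAlgebra.single g (v (κ g)) = ∑ k : C, v k • setSum (S.cl k) := by
    ext g
    rw [coeff_sum_single]
    simp only [MonoidAlgebra.coeff_sum, Finsupp.finsetSum_apply,
      MonoidAlgebra.coeff_smul_apply, coeff_setSum, Set.indicator_apply,
      ← S.eq_iff_mem_cl_of_isClassReps hC hκ]
    simp
  rw [h]
  exact Subalgebra.sum_mem _ fun k _ =>
    Subalgebra.smul_mem _ (S.cl_mem_superclasses (k : G)).1.1.2 _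

/-- The fibres of `κ` are the classes, and the summand is constant on each of them. -/
theorem centralChar_sum_single_comp (S : SupercharacterTheory G) {C : Finset G}
    (hC : S.IsClassReps C) {κ : G → C} (hκ : ∀ g : G, (κ g : G) ∈ S.cl g) (v : C → ℂ)
    {χ : G → ℂ} (hχ : χ ∈ S.basicChars) :
    centralChar χ (∑ g : G, MonoidAlgebra.single g (v (κ g))) =
      ∑ k : C, χ k * ((S.cl k).ncard : ℂ) / χ 1 * v k := by
  classical
  obtain ⟨X, hX, rfl⟩ := hχ
  simp only [centralChar, coeff_sum_single]
  rw [← Finset.sum_fiberwise Finset.univ κ, Finset.sum_div]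
  refine Finset.sum_congr rfl fun k _ => ?_
  have hcard : (S.cl k).ncard = (Finset.univ.filter fun g => κ g = k).card := by
    rw [← Set.ncard_coe_finset]
    congr 1
    ext g
    simp [S.eq_iff_mem_cl_of_isClassReps hC hκ]
  have hterm : ∀ g ∈ Finset.univ.filter fun g => κ g = k,
      v (κ g) * sigma X g = v k * sigma X k := by
    intro g hg
    have hg : κ g = k := by simpa using hg
    have hk := S.cl_mem_superclasses (k : G)
    rw [hg, S.sigma_eq_of_mem_superclass hX hk.1 hk.2
      ((S.eq_iff_mem_cl_of_isClassReps hC hκ g k).1 hg)]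
  rw [Finset.sum_congr rfl hterm, Finset.sum_const, nsmul_eq_mul, hcard]
  ring

end SupercharacterTheory

theorem theoremA {G : Type*} [Group G] [Fintype G] [DecidableEq G]
    (S : SupercharacterTheory G) (C : Finset G) (hC : S.IsClassReps C)
    (κ : G → C) (hκ : ∀ g : G, (κ g : G) ∈ S.cl g) :
    Matrix.det (Matrix.of fun g h : G => (MvPolynomial.X (κ (g * h⁻¹)) : MvPolynomial C ℂ)) =
      ∏ χ ∈ S.finite_basicChars.toFinset,
        (∑ g : C, MvPolynomial.C (χ g * ((S.cl g).ncard : ℂ) / χ 1) * MvPolynomial.X g) ^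
          SupercharacterTheory.degree χ := by
  -- Polynomials over the infinite field `ℂ` agree if all their values do.
  refine MvPolynomial.funext fun v => ?_
  have hdet := S.det_groupMatrix (S.sum_single_comp_mem hC hκ v)
  rw [RingHom.map_det, map_prod]
  convert hdet using 1
  · congr 1
    ext g h
    rw [SupercharacterTheory.groupMatrix_apply, SupercharacterTheory.coeff_sum_single]
    simp
  · refine Finset.prod_congr rfl fun χ hχ => ?_
    rw [S.centralChar_sum_single_comp hC hκ v (by simpa using hχ)]
    simp
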